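/- Conventions. For infinite cardinals $\kappa\le\sigma$, $P_\kappa(\sigma)$ is the set of all $a\subseteq\sigma$ with $|a|<\kappa$, ordered by inclusion, and $u(\kappa,\sigma)$ is the least size of a cofinal subset of $(P_\kappa(\sigma),\subseteq)$. An ideal on a set $X$ is a nonempty family of subsets of $X$ that is closed under subsets and finite unions and does not contain $X$; for an ideal $K$ on $X$, $K^*=\{A\subseteq X: X\setminus A\in K\}$. Let $\mu<\kappa$ be infinite cardinals. A set $C\subseteq P_\kappa(\sigma)$ is a $\mu$-club if it is cofinal in $P_\kappa(\sigma)$ and $\bigcup_{i<\mu}a_i\in C$ for every $\subset$-increasing sequence $\langle a_i:i<\mu\rangle$ of members of $C$. Let $N\mu\text{-}S_{\kappa,\sigma}$ be the set of all $B\subseteq P_\kappa(\sigma)$ such that $B\cap C=\emptyset$ for some $\mu$-club $C\subseteq P_\kappa(\sigma)$. An ideal $K_1$ on $X_1$ is isomorphic to an ideal $K_2$ on $X_2$ if there are $W_1\in K_1^*$, $W_2\in K_2^*$ and a bijection $k:W_1\to W_2$ such that $k``A\in K_2^*$ for every $A\in K_1^*$ with $A\subseteq W_1$, and every $B\in K_2^*$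 with $B\subseteq W_2$ is $k``A$ for a unique $A\in K_1^*$ with $A\subseteq W_1$. A pseudo-Kurepa family for $P_\kappa(\lambda)$ is a set $F\subseteq P_\kappa(\lambda)$ such that $|F\cap P(a)|<\kappa$ for every $a\in P_\kappa(\lambda)$. For a singular cardinal $\sigma$, $\mathrm{pp}(\sigma)$ is the supremum of all regular cardinals $\pi$ such that, for some infinite set $A$ of regular infinite cardinals with $|A|<\min A$ and $\sup A=\sigma$, and some ideal $I$ on $A$, there is a sequence $\langle f_\xi:\xi<\pi\rangle$ of members of $\prod A$ with $\{a\in A: f_\xi(a)<f_\eta(a)\}\in I^*$ for all $\xi<\eta<\pi$, such that for every $g\in\prod A$ there is $\xi<\pi$ with $\{a\in A: g(a)\le f_\xi(a)\}\in I^*$. Shelah's Strong Hypothesis (SSH) asserts that $\mathrm{pp}(\sigma)=\sigma^+$ for every singular cardinal $\sigma$. Proposition 1.18. Let $\mu<\kappa<\lambda$ be infinite cardinals with $\mu$ and $\kappa$ regular. Suppose that SSH holds, $\mathrm{cf}(\lambda)<\mu$, and $\kappa=\nu^+$ for a cardinal $\nu$ with $\mathrm{cf}(\nu)\neq\mathrm{cf}(\lambda)$.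 Suppose further that there is a pseudo-Kurepa family for $P_\kappa(\lambda)$ of size $u(\kappa,\lambda)$. Then $N\mu\text{-}S_{\kappa,\lambda}$ and $N\mu\text{-}S_{\kappa,u(\kappa,\lambda)}$ are isomorphic ideals. -/

import Mathlib

universe u

/-- `K` is a (proper) ideal on the set `X`: a nonempty family of subsets of `X`, closed under
subsets and (finite) unions, that does not contain `X` itself. -/
def IsIdealOn {X : Type*} (K : Set (Set X)) : Prop :=
  Order.IsIdeal K ∧ Set.univ ∉ K

/-- The filter `K* = {A ⊆ X : X \ A ∈ K}` dual to `K`. -/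
def dualFamily {X : Type*} (K : Set (Set X)) : Set (Set X) :=
  {A | Aᶜ ∈ K}

/-- `K₁` and `K₂` are ideals, on `X₁` and `X₂` respectively, and they are isomorphic: there are
`W₁ ∈ K₁*`, `W₂ ∈ K₂*` and a bijection `k : W₁ → W₂` such that `k '' A ∈ K₂*` for each `A ∈ K₁*`
with `A ⊆ W₁`, and each `B ∈ K₂*` with `B ⊆ W₂` equals `k '' A` for a unique `A ∈ K₁*` with
`A ⊆ W₁`.  (The values of `k` outside `W₁` are irrelevant.) -/
def IdealsIsomorphic {X₁ X₂ : Type*} (K₁ : Set (Set X₁)) (K₂ : Set (Set X₂)) : Prop :=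
  IsIdealOn K₁ ∧ IsIdealOn K₂ ∧
    ∃ W₁ ∈ dualFamily K₁, ∃ W₂ ∈ dualFamily K₂, ∃ k : X₁ → X₂, Set.BijOn k W₁ W₂ ∧
      (∀ A ∈ dualFamily K₁, A ⊆ W₁ → k '' A ∈ dualFamily K₂) ∧
      (∀ B ∈ dualFamily K₂, B ⊆ W₂ → ∃! A : Set X₁, A ∈ dualFamily K₁ ∧ A ⊆ W₁ ∧ B = k '' A)

/-- `P_κ(lam)`: the subsets of (the set of ordinals less than) `lam` of size less than `κ`,
ordered by inclusion. -/
abbrev PKappa (κ lam : Cardinal.{u}) : Type u :=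
  {a : Set lam.ord.ToType // Cardinal.mk a < κ}

/-- `u(κ, lam)`: the least size of a cofinal subset of `(P_κ(lam), ⊆)`. -/
noncomputable def coveringNumber (κ lam : Cardinal.{u}) : Cardinal.{u} :=
  Order.cof (PKappa κ lam)

/-- `A ⊆ P_κ(lam)` is `μ`-closed: the union of any strictly increasing sequence of length `μ` of
members of `A` belongs to `A`. -/
def IsMuClosed (μ : Cardinal.{u}) {κ lam : Cardinal.{u}} (A : Set (PKappa κ lam)) : Prop :=
  ∀ s : μ.ord.ToType → PKappa κ lam, StrictMono s → (∀ i, s i ∈ A) →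
    ∃ c ∈ A, (c : Set lam.ord.ToType) = ⋃ i, (s i : Set lam.ord.ToType)

/-- A `μ`-club of `P_κ(lam)`: a `μ`-closed, cofinal subset. -/
def IsMuClub (μ : Cardinal.{u}) {κ lam : Cardinal.{u}} (C : Set (PKappa κ lam)) : Prop :=
  IsMuClosed μ C ∧ IsCofinal C

/-- `Nμ-S_{κ,lam}`: the sets `B ⊆ P_κ(lam)` that are disjoint from some `μ`-club. -/
def muNonstationary (μ κ lam : Cardinal.{u}) : Set (Set (PKappa κ lam)) :=
  {B | ∃ C : Set (PKappa κ lam), IsMuClub μ C ∧ B ∩ C = ∅}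

/-- `F` is a pseudo-Kurepa family for `P_κ(lam)`: a subset of `P_κ(lam)` such that each member
of `P_κ(lam)` includes fewer than `κ` members of `F`. -/
def IsPseudoKurepa {κ lam : Cardinal.{u}} (F : Set (PKappa κ lam)) : Prop :=
  ∀ a : PKappa κ lam, Cardinal.mk {y : PKappa κ lam | y ∈ F ∧ y ≤ a} < κ

/-- `f = ⟨f ξ : ξ < π⟩` is a scale in `∏ A / I`: it consists of members of `∏ A` (functions `g`
on `A` with `g a < a` for all `a ∈ A`), it is `<_I`-increasing, and every member of `∏ A` is
`≤_I` some `f ξ`.  Only the values `f ξ` with `ξ < π` matter. -/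
def IsScaleIn (A : Set Cardinal.{u}) (I : Set (Set A)) (π : Cardinal.{u})
    (f : Ordinal.{u} → A → Ordinal.{u}) : Prop :=
  (∀ ξ < π.ord, ∀ a : A, f ξ a < (a : Cardinal.{u}).ord) ∧
  (∀ η < π.ord, ∀ ξ < η, {a : A | f ξ a < f η a} ∈ dualFamily I) ∧
  (∀ g : A → Ordinal.{u}, (∀ a : A, g a < (a : Cardinal.{u}).ord) →
    ∃ ξ < π.ord, {a : A | g a ≤ f ξ a} ∈ dualFamily I)

/-- `π` is the length of some scale for `σ`: `π` is regular, and for some infinite set `A` of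
regular infinite cardinals with `|A| < min A` and `sup A = σ`, and some ideal `I` on `A`, there
is a scale of length `π` in `∏ A / I`, that is, `tcf (∏ A / I) = π`. -/
def IsScaleLength (σ π : Cardinal.{u}) : Prop :=
  π.IsRegular ∧ ∃ A : Set Cardinal.{u}, A.Infinite ∧ (∀ a ∈ A, a.IsRegular) ∧
    (∀ a ∈ A, Cardinal.mk A < Cardinal.lift.{u + 1} a) ∧ IsLUB A σ ∧
    ∃ I : Set (Set A), IsIdealOn I ∧ ∃ f : Ordinal.{u} → A → Ordinal.{u}, IsScaleIn A I π f

/-- `pp(σ)`: the supremum of the lengths of the scales for `σ`. -/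
noncomputable def pseudopower (σ : Cardinal.{u}) : Cardinal.{u} :=
  sSup {π | IsScaleLength σ π}

/-- The supremum in the definition of `pp(σ)` is that of a bounded set. -/
theorem bddAbove_scaleLength (σ : Cardinal.{u}) : BddAbove {π | IsScaleLength σ π} := by
  classical
  refine ⟨Cardinal.mk (Shrink.{u} (Set.Iic σ → Set.Iic σ.ord)), ?_⟩
  rintro π ⟨-, A, -, -, -, hA, I, hI, f, hf, hinc, -⟩
  have key : ∀ ξ < π.ord, ∀ η < π.ord, ξ < η → f ξ ≠ f η := by
    intro ξ _ η hη h e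
    have := hinc η hη ξ h
    simp only [e, lt_self_iff_false, dualFamily, Set.mem_ofPred_eq, Set.ofPred_false,
      Set.compl_empty] at this
    exact hI.2 this
  let F : Set.Iio π.ord → (Set.Iic σ → Set.Iic σ.ord) := fun ξ c =>
    if h : (c : Cardinal.{u}) ∈ A then
      ⟨f ξ ⟨c, h⟩, (hf ξ ξ.2 ⟨c, h⟩).le.trans (Cardinal.ord_le_ord.2 c.2)⟩
    else ⟨0, by simp⟩
  have hF : Function.Injective F := by
    intro ξ η e
    have e' : f ξ = f η := by
      funext a
      have h := congrFun e ⟨a, hA.1 a.2⟩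
      simpa [F] using h
    rcases lt_trichotomy (ξ : Ordinal.{u}) η with h | h | h
    · exact absurd e' (key _ ξ.2 _ η.2 h)
    · exact Subtype.ext h
    · exact absurd e'.symm (key _ η.2 _ ξ.2 h)
  have h2 := Cardinal.mk_le_of_injective
    (((equivShrink.{u} (Set.Iic σ → Set.Iic σ.ord)).injective.comp hF).comp
      (Ordinal.ToType.mk (o := π.ord)).symm.injective)
  simpa using h2

/-- Shelah's Strong Hypothesis: `pp(σ) = σ⁺` for every singular cardinal `σ`. -/
def SSH : Prop :=
  ∀ σ : Cardinal.{u}, σ.IsSingular → pseudopower σ = Order.succ σ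

open Cardinal Set

/-! Suppose `z α`, for `α < u(κ, λ)`, are subsets of `λ` of size less than `μ` that include all
singletons, such that each `a ∈ P_κ(λ)` includes fewer than `κ` of them. Then `h(a) = {α | z α ⊆ a}`
maps `P_κ(λ)` into `P_κ(u(κ, λ))`. The singletons make it an order embedding, its range is cofinal
because `x ⊆ h(⋃ α ∈ x, z α)`, and regularity of `μ` makes it commute with unions of increasing
`μ`-sequences. So `h` carries `μ`-clubs to `μ`-clubs in both directions
(`idealsIsomorphic_of_isThin`).

A pseudo-Kurepa family provides such sets, except that their size is only at most `ν`. SSH shrinks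
them: by `exists_cof_covering`, at most `λ` sets cover every `y ⊆ λ` of size at most `ν` by `cf(λ)`
many of them, so `y` can be replaced by the set of codes of its covering sets
(`IsThin.exists_small`).

The covering comes from pcf theory. SSH bounds the cofinalities of ultraproducts of regular
cardinals at most `τ` by `τ⁺`. Universal sequences and a compactness argument turn this into
everywhere-dominating families of size `τ⁺` (`exists_cofinal_family`). These guide a walk down the
ordinals that reaches every point of `y` in finitely many steps (`exists_countable_covering`). -/

/-! ### Preliminaries on ordinals and cofinality. -/

theorem toType_mk_coe {o : Ordinal.{u}} (x : o.ToType) (h : (x : Ordinal.{u}) < o) :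
    Ordinal.ToType.mk ⟨(x : Ordinal.{u}), h⟩ = x :=
  Ordinal.ToType.mk.apply_symm_apply x

theorem exists_forall_lt_of_isRegular {π : Cardinal.{u}} (hπ : π.IsRegular) {β : Type u}
    (hβ : #β < π) (g : β → π.ord.ToType) : ∃ x, ∀ b, g b < x := by
  have h : (⨆ b, ((g b : Ordinal.{u}) + 1)) < π.ord :=
    Ordinal.iSup_add_one_lt_of_lt_cof (by rwa [hπ.cof_ord]) fun b => (g b).toOrd.2
  refine ⟨Ordinal.ToType.mk ⟨_, h⟩, fun b => ?_⟩
  rw [← Ordinal.ToType.mk.symm_apply_lt]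
  exact Ordinal.lt_iSup_add_one (fun b => (g b : Ordinal.{u})) b

/-- A monotone cofinal map from the cofinality of an ordinal. -/
theorem exists_monotone_cofinal (δ : Ordinal.{u}) :
    ∃ e : δ.cof.ord.ToType → Ordinal.{u}, Monotone e ∧ (∀ k, e k < δ) ∧
      ∀ β < δ, ∃ k, β ≤ e k := by
  obtain ⟨s, hs, hs'⟩ := Ordinal.exists_ord_cof_eq δ.ToType
  rw [Ordinal.cof_toType, ← Ordinal.type_toType δ.cof.ord, Ordinal.type_eq] at hs'
  obtain ⟨φ⟩ := hs'
  refine ⟨fun k => ((φ.symm k : δ.ToType) : Ordinal.{u}), ?_, fun k => (φ.symm k).1.toOrd.2, ?_⟩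
  · intro k l hkl
    have h : φ.symm k ≤ φ.symm l := (OrderIso.ofRelIsoLT φ.symm).monotone hkl
    exact (Ordinal.ToType.mk.symm).monotone h
  · intro β hβ
    obtain ⟨x, hx, hx'⟩ := hs (Ordinal.ToType.mk ⟨β, hβ⟩)
    refine ⟨φ ⟨x, hx⟩, ?_⟩
    rw [← Ordinal.ToType.mk.le_symm_apply] at hx'
    have hx'' : β ≤ (x : Ordinal.{u}) := hx'
    simpa using hx''

/-! ### Scales in ultraproducts and universal sequences. -/

/-- `g` belongs to the product of the cardinals `c i`. -/
def InProduct {ι : Type u} (c : ι → Cardinal.{u}) (g : ι → Ordinal.{u}) : Prop :=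
  ∀ i, g i < (c i).ord

/-- `F` is increasing and cofinal in the ultraproduct of the cardinals `c i` by `D`. -/
structure IsUltraScale {ι : Type u} (c : ι → Cardinal.{u}) (D : Ultrafilter ι) {π : Cardinal.{u}}
    (F : π.ord.ToType → ι → Ordinal.{u}) : Prop where
  inProduct : ∀ ξ, InProduct c (F ξ)
  lt : ∀ ξ η, ξ < η → ∀ᶠ i in D, F ξ i < F η i
  cofinal : ∀ g, InProduct c g → ∃ ξ, ∀ᶠ i in D, g i ≤ F ξ i

theorem InProduct.sup {ι : Type u} {c : ι → Cardinal.{u}} {f g : ι → Ordinal.{u}}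
    (hf : InProduct c f) (hg : InProduct c g) : InProduct c (f ⊔ g) :=
  fun i => max_lt (hf i) (hg i)

theorem InProduct.iSup {ι β : Type u} {c : ι → Cardinal.{u}} (hc : ∀ i, (c i).IsRegular)
    (hβ : ∀ i, #β < c i) {s : β → ι → Ordinal.{u}} (hs : ∀ b, InProduct c (s b)) :
    InProduct c (fun i => ⨆ b, s b i) :=
  fun i => Ordinal.iSup_lt_of_lt_cof (by rw [(hc i).cof_ord]; exact hβ i) fun b => hs b i

theorem InProduct.succ {ι : Type u} {c : ι → Cardinal.{u}} (hc : ∀ i, (c i).IsRegular)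
    {f : ι → Ordinal.{u}} (hf : InProduct c f) : InProduct c (fun i => Order.succ (f i)) :=
  fun i => (isSuccLimit_ord (hc i).aleph0_le).succ_lt (hf i)

theorem inProduct_zero {ι : Type u} {c : ι → Cardinal.{u}} (hc : ∀ i, (c i).IsRegular) :
    InProduct c 0 := fun i => (hc i).ord_pos

/-- Every ultraproduct of regular cardinals has a scale of regular length. -/
theorem exists_isUltraScale {ι : Type u} {c : ι → Cardinal.{u}} (hc : ∀ i, (c i).IsRegular)
    (D : Ultrafilter ι) :
    ∃ π : Cardinal.{u}, π.IsRegular ∧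
      ∃ F : π.ord.ToType → ι → Ordinal.{u}, IsUltraScale c D F := by
  let S : Set Cardinal.{u} := {π | ∃ s : π.ord.ToType → ι → Ordinal.{u},
    (∀ ξ, InProduct c (s ξ)) ∧ ∀ g, InProduct c g → ∃ ξ, ∀ᶠ i in D, g i ≤ s ξ i}
  have memS : ∀ (β : Type u) (s : β → ι → Ordinal.{u}), (∀ b, InProduct c (s b)) →
      (∀ g, InProduct c g → ∃ b, ∀ᶠ i in D, g i ≤ s b i) → #β ∈ S := by
    intro β s h1 h2
    obtain ⟨e⟩ := Cardinal.eq.1 (mk_ord_toType #β)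
    refine ⟨fun ξ => s (e ξ), fun ξ => h1 _, fun g hg => ?_⟩
    obtain ⟨b, hb⟩ := h2 g hg
    exact ⟨e.symm b, by simpa using hb⟩
  have hS : S.Nonempty := by
    refine ⟨_, memS (∀ i, (c i).ord.ToType) (fun b i => (b i : Ordinal.{u}))
      (fun b i => (b i).toOrd.2) fun g hg => ⟨fun i => Ordinal.ToType.mk ⟨g i, hg i⟩, ?_⟩⟩
    simp
  obtain ⟨π, ⟨s, hs1, hs2⟩, hmin⟩ := WellFounded.has_min Cardinal.lt_wf S hS
  -- Modulo an ultrafilter, a family without a strict upper bound is cofinal, so minimality of `π`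
  -- gives fewer than `π` functions a strict bound. This drives the recursion and yields regularity.
  have key : ∀ (β : Type u) (t : β → ι → Ordinal.{u}), #β < π → (∀ b, InProduct c (t b)) →
      ∃ g, InProduct c g ∧ ∀ b, ∀ᶠ i in D, t b i < g i := by
    intro β t hβ ht
    by_contra! h
    exact hmin _ (memS β t ht h) hβ
  have step : ∀ (ξ : π.ord.ToType) (p : ∀ η, η < ξ → {g // InProduct c g}),
      ∃ g : {g // InProduct c g}, (∀ η (h : η < ξ), ∀ᶠ i in D, (p η h).1 i < g.1 i) ∧
        ∀ᶠ i in D, s ξ i ≤ g.1 i := by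
    intro ξ p
    obtain ⟨g, hg, hg'⟩ := key (Iio ξ) (fun η => (p η.1 η.2).1) ((mk_Iio_lt ξ (by simp)).trans_eq (mk_ord_toType π))
      fun η => (p η.1 η.2).2
    refine ⟨⟨g ⊔ s ξ, hg.sup (hs1 ξ)⟩, fun η h => ?_, .of_forall fun i => le_sup_right⟩
    exact (hg' ⟨η, h⟩).mono fun i hi => lt_sup_of_lt_left hi
  choose next hnext1 hnext2 using step
  let F : π.ord.ToType → {g // InProduct c g} :=
    (wellFounded_lt (α := π.ord.ToType)).fix next
  have hF : ∀ ξ, F ξ = next ξ fun η _ => F η := fun ξ => WellFounded.fix_eq _ _ _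
  have hlt : ∀ ξ η, ξ < η → ∀ᶠ i in D, (F ξ).1 i < (F η).1 i := by
    intro ξ η h
    rw [hF η]
    exact hnext1 η (fun η _ => F η) ξ h
  have hcof : ∀ g, InProduct c g → ∃ ξ, ∀ᶠ i in D, g i ≤ (F ξ).1 i := by
    intro g hg
    obtain ⟨ξ, hξ⟩ := hs2 g hg
    refine ⟨ξ, ?_⟩
    rw [hF ξ]
    filter_upwards [hξ, hnext2 ξ fun η _ => F η] with i h1 h2 using h1.trans h2
  have hle : ∀ ξ η, ξ ≤ η → ∀ᶠ i in D, (F ξ).1 i ≤ (F η).1 i := by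
    intro ξ η h
    rcases h.eq_or_lt with rfl | h
    · exact .of_forall fun i => le_rfl
    · exact (hlt ξ η h).mono fun i hi => hi.le
  refine ⟨π, ⟨?_, ?_⟩, fun ξ => (F ξ).1, fun ξ => (F ξ).2, hlt, hcof⟩
  · by_contra! hfin
    have : Finite π.ord.ToType := by
      rw [← Cardinal.lt_aleph0_iff_finite, mk_ord_toType]
      exact hfin
    obtain ⟨ξ₀, -⟩ := hcof 0 (inProduct_zero hc)
    have : Nonempty π.ord.ToType := ⟨ξ₀⟩
    obtain ⟨m, hm⟩ := Finite.exists_max (id : π.ord.ToType → _)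
    obtain ⟨ξ, hξ⟩ := hcof _ ((F m).2.succ hc)
    obtain ⟨i, h1, h2⟩ := (hξ.and (hle ξ m (hm ξ))).exists
    exact absurd (h1.trans h2) (Order.lt_succ _).not_ge
  · by_contra! hlt'
    obtain ⟨e, -, he1, he2⟩ := exists_monotone_cofinal π.ord
    obtain ⟨g, hg, hg'⟩ := key π.ord.cof.ord.ToType
      (fun k => (F (Ordinal.ToType.mk ⟨e k, he1 k⟩)).1)
      (by rwa [mk_ord_toType]) fun k => (F _).2
    obtain ⟨ξ, hξ⟩ := hcof g hg
    obtain ⟨k, hk⟩ := he2 ξ ξ.toOrd.2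
    have h : ξ ≤ Ordinal.ToType.mk ⟨e k, he1 k⟩ := by
      rw [← Ordinal.ToType.mk.symm_apply_le]
      exact hk
    obtain ⟨i, h1, h2, h3⟩ := ((hg' k).and (hξ.and (hle _ _ h))).exists
    exact absurd (h2.trans h3) h1.not_ge

/-- Otherwise the successor of the pointwise supremum of the whole scale would lie in the product.
-/
theorem IsUltraScale.lt_length {ι : Type u} {c : ι → Cardinal.{u}} (hc : ∀ i, (c i).IsRegular)
    {D : Ultrafilter ι} {π χ : Cardinal.{u}} {F : π.ord.ToType → ι → Ordinal.{u}}
    (hF : IsUltraScale c D F) (hχ : ∀ i, χ < c i) : χ < π := by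
  by_contra! h
  obtain ⟨ξ, hξ⟩ := hF.cofinal _
    ((InProduct.iSup (β := π.ord.ToType) hc (fun i => by
      rw [mk_ord_toType]; exact h.trans_lt (hχ i)) hF.inProduct).succ hc)
  obtain ⟨i, hi⟩ := hξ.exists
  exact absurd (Order.succ_le_iff.1 hi) (Ordinal.le_iSup (fun b => F b i) ξ).not_gt

/-- Universal sequences: a single family of length `π` is cofinal in all ultraproducts of the
cardinals `c i` whose cofinality is `π`. -/
theorem exists_universal_sequence {ι : Type u} {c : ι → Cardinal.{u}} (hc : ∀ i, (c i).IsRegular)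
    (hι : ∀ i, Order.succ #ι < c i) {π : Cardinal.{u}} (hπ : π.IsRegular) :
    ∃ f : π.ord.ToType → ι → Ordinal.{u}, (∀ ξ, InProduct c (f ξ)) ∧
      ∀ (D : Ultrafilter ι) (F : π.ord.ToType → ι → Ordinal.{u}), IsUltraScale c D F →
        ∀ g, InProduct c g → ∃ ξ, ∀ᶠ i in D, g i ≤ f ξ i := by
  -- Along `|ι|⁺` stages, each family dominates every earlier one joined with a scale for an
  -- ultraproduct where that earlier family fails, as witnessed by `h`. With `H` the supremum of the
  -- witnesses and one large `ξ`, each stage first reaches `H` at some coordinate. These coordinates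
  -- are distinct, and there are too many of them.
  by_contra! hbad
  let P := {f : π.ord.ToType → ι → Ordinal.{u} // ∀ ξ, InProduct c (f ξ)}
  choose D G hG h hh hlt using fun f : P => hbad f.1 f.2
  let N : P → P := fun f => ⟨fun ξ => f.1 ξ ⊔ G f ξ, fun ξ => (f.2 ξ).sup ((hG f).inProduct ξ)⟩
  let Ω := (Order.succ #ι).ord.ToType
  have hΩ : ∀ i, #Ω < c i := fun i => by
    simpa [Ω] using hι i
  have hIio : ∀ (α : Ω) i, #(Iio α) < c i := fun α i => (mk_set_le _).trans_lt (hΩ i)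
  let step : ∀ α : Ω, (∀ β, β < α → P) → P := fun α p =>
    ⟨fun ξ i => ⨆ β : Iio α, (N (p β.1 β.2)).1 ξ i, fun ξ =>
      InProduct.iSup hc (hIio α) fun β => (N (p β.1 β.2)).2 ξ⟩
  let f : Ω → P := (wellFounded_lt (α := Ω)).fix step
  have hf : ∀ α, f α = step α fun β _ => f β := fun α => WellFounded.fix_eq _ _ _
  have hmono : ∀ α β, α < β → ∀ ξ i, (N (f α)).1 ξ i ≤ (f β).1 ξ i := by
    intro α β hαβ ξ i
    rw [hf β]
    exact Ordinal.le_iSup (fun γ : Iio β => (N (f γ)).1 ξ i) ⟨α, hαβ⟩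
  let H : ι → Ordinal.{u} := fun i => ⨆ α : Ω, h (f α) i
  have hH : InProduct c H := InProduct.iSup hc hΩ fun α => hh (f α)
  choose x hx using fun α : Ω => (hG (f α)).cofinal H hH
  have : ∃ ξ, ∀ α, x α < ξ := by
    rcases isEmpty_or_nonempty ι with hι' | ⟨⟨i⟩⟩
    · exact ((D (f (Ordinal.ToType.mk ⟨0, by simp⟩))).nonempty_of_mem Filter.univ_mem).elim
        fun i => hι'.elim i
    · refine exists_forall_lt_of_isRegular hπ ?_ x
      exact (hG (f (Ordinal.ToType.mk ⟨0, by simp⟩))).lt_length hc hΩ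
  obtain ⟨ξ, hξ⟩ := this
  have hpt : ∀ α, ∃ i, H i ≤ (N (f α)).1 ξ i ∧ ¬ H i ≤ (f α).1 ξ i := by
    intro α
    obtain ⟨i, h1, h2, h3⟩ := ((hx α).and (((hG (f α)).lt _ _ (hξ α)).and (hlt (f α) ξ))).exists
    refine ⟨i, (h1.trans h2.le).trans le_sup_right, fun h4 => h3.not_ge ?_⟩
    exact (Ordinal.le_iSup (fun α : Ω => h (f α) i) α).trans h4
  choose a ha1 ha2 using hpt
  have hinj : Function.Injective a := by
    have : ∀ α β, α < β → a α ≠ a β := fun α β hαβ e =>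
      ha2 β (e ▸ (ha1 α).trans (hmono α β hαβ ξ _))
    intro α β e
    by_contra hne
    rcases lt_or_gt_of_ne hne with h | h
    · exact this _ _ h e
    · exact this _ _ h e.symm
  have := mk_le_of_injective hinj
  simp [Ω] at this

/-! ### Cofinal families in products under SSH. -/

/-- Under `SSH`, ultraproducts of progressive families of distinct regular cardinals at most `τ`
have cofinality at most `τ⁺`. -/
theorem IsUltraScale.length_le (hSSH : SSH.{u}) {ι : Type u} {c : ι → Cardinal.{u}}
    (hc : ∀ i, (c i).IsRegular) (hinj : Function.Injective c) (hι : ∀ i, #ι < c i)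
    {τ : Cardinal.{u}} (hτ : ∀ i, c i ≤ τ) {D : Ultrafilter ι} {π : Cardinal.{u}}
    (hπ : π.IsRegular) {F : π.ord.ToType → ι → Ordinal.{u}} (hF : IsUltraScale c D F) :
    π ≤ Order.succ τ := by
  classical
  let S : Set Cardinal.{u} := {σ | ∀ᶠ i in D, c i ≤ σ}
  have hτS : τ ∈ S := .of_forall hτ
  -- `σ` is the `D`-limit of the `c i`. If it is attained `D`-almost everywhere, `D` is principal;
  -- otherwise `σ` is singular and `π` is one of the lengths defining `pp(σ)`.
  obtain ⟨σ, hσ, hmin⟩ := WellFounded.has_min Cardinal.lt_wf S ⟨τ, hτS⟩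
  have hστ : σ ≤ τ := not_lt.1 (hmin τ hτS)
  by_cases hcase : ∀ᶠ i in D, c i = σ
  · obtain ⟨i₀, hi₀⟩ := hcase.exists
    have hpure : ∀ᶠ i in D, i = i₀ := hcase.mono fun i hi => hinj (hi.trans hi₀.symm)
    refine le_trans ?_ (hστ.trans (Order.le_succ τ))
    rw [← mk_ord_toType π, ← mk_ord_toType σ]
    refine mk_le_of_injective (f := fun ξ => Ordinal.ToType.mk
      ⟨F ξ i₀, by rw [mem_Iio, ← hi₀]; exact hF.inProduct ξ i₀⟩) ?_
    have : ∀ ξ η, ξ < η → F ξ i₀ < F η i₀ := by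
      intro ξ η h
      obtain ⟨i, h1, rfl⟩ := ((hF.lt ξ η h).and hpure).exists
      exact h1
    intro ξ η e
    have e' : F ξ i₀ = F η i₀ := congrArg Subtype.val (Ordinal.ToType.mk.injective e)
    by_contra hne
    rcases lt_or_gt_of_ne hne with h | h
    · exact (this _ _ h).ne e'
    · exact (this _ _ h).ne' e'
  have hT : ∀ᶠ i in D, c i < σ := by
    rw [← Ultrafilter.frequently_iff_eventually, Filter.Frequently, not_not] at hcase
    filter_upwards [hσ, hcase] with i h1 h2 using lt_of_le_of_ne h1 h2
  let T : Set ι := {i | c i < σ}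
  let A : Set Cardinal.{u} := c '' T
  have hlub : IsLUB A σ := by
    refine ⟨?_, fun b hb => ?_⟩
    · rintro _ ⟨i, hi, rfl⟩
      exact le_of_lt hi
    · refine not_lt.1 (hmin b ?_)
      exact hT.mono fun i hi => hb ⟨i, hi, rfl⟩
  obtain ⟨i₁, hi₁⟩ := hT.exists
  have hsing : σ.IsSingular := by
    refine .of_not_isRegular ((hc i₁).aleph0_le.trans hi₁.le) fun hreg => ?_
    have h1 : (⨆ i : T, c i) < σ := by
      refine iSup_lt_of_lt_cof_ord ?_ fun i => i.2
      rw [hreg.cof_ord]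
      exact (mk_set_le T).trans_lt ((hι i₁).trans hi₁)
    refine hmin _ ?_ h1
    exact hT.mono fun i hi => le_ciSup (f := fun i : T => c i) bddAbove_of_small ⟨i, hi⟩
  choose r hrT hr using fun a : A => a.2
  let E : Ultrafilter A := (D.map c).comap Subtype.val_injective (by
    rw [Subtype.range_coe]
    exact hT.mono fun i hi => ⟨i, hi, rfl⟩)
  have hE : ∀ p : ι → Prop, (∀ᶠ i in D, p i) → {a : A | p (r a)} ∈ E := by
    intro p hp
    rw [Ultrafilter.mem_comap, Ultrafilter.mem_map]
    filter_upwards [hp, hT] with i h1 h2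
    refine ⟨⟨c i, i, h2, rfl⟩, ?_, rfl⟩
    have : r ⟨c i, i, h2, rfl⟩ = i := hinj (hr _)
    rw [mem_ofPred_eq, this]
    exact h1
  let I : Set (Set A) := {X | X ∉ E}
  have hdual : ∀ X, X ∈ dualFamily I ↔ X ∈ E := by
    intro X
    change Xᶜ ∉ E ↔ X ∈ E
    rw [Ultrafilter.compl_notMem_iff]
  have hI : IsIdealOn I := by
    refine ⟨⟨fun X Y hYX hX hY => hX (Filter.mem_of_superset hY hYX), ⟨∅, E.empty_notMem⟩, ?_⟩,
      fun h => h Filter.univ_mem⟩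
    intro X hX Y hY
    exact ⟨X ∪ Y, fun h => (Ultrafilter.union_mem_iff.1 h).elim hX hY, subset_union_left,
      subset_union_right⟩
  have hlen : IsScaleLength σ π := by
    refine ⟨hπ, A, ?_, ?_, ?_, hlub, I, hI, fun ξ a =>
      if h : ξ < π.ord then F (Ordinal.ToType.mk ⟨ξ, h⟩) (r a) else 0, ?_, ?_, ?_⟩
    · intro hfin
      obtain ⟨m, hm⟩ := hfin.exists_maximal ⟨_, i₁, hi₁, rfl⟩
      have hmσ : m < σ := by
        obtain ⟨i, hi, rfl⟩ := hm.1
        exact hi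
      refine hmin m (hT.mono fun i hi => ?_) hmσ
      rcases le_total (c i) m with h | h
      · exact h
      · exact hm.2 ⟨i, hi, rfl⟩ h
    · rintro _ ⟨i, -, rfl⟩
      exact hc i
    · rintro _ ⟨i, -, rfl⟩
      have h1 := mk_image_le_lift (f := c) (s := T)
      rw [Cardinal.lift_id'.{u, u + 1}] at h1
      refine h1.trans_lt ?_
      rw [Cardinal.lift_lt]
      exact (mk_set_le T).trans_lt (hι i)
    · intro ξ hξ a
      simp only [hξ, dite_true]
      conv_rhs => rw [← hr a]
      exact hF.inProduct _ _
    · intro η hη ξ hξ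
      rw [hdual]
      simp only [hη, hξ.trans hη, dite_true]
      exact hE _ (hF.lt _ _ (Ordinal.ToType.mk.lt_iff_lt.2 hξ))
    · intro g hg
      obtain ⟨ξ, hξ⟩ := hF.cofinal (fun i => if h : c i ∈ A then g ⟨c i, h⟩ else 0) (by
        intro i
        dsimp only
        split_ifs with h
        · exact hg ⟨c i, h⟩
        · exact (hc i).ord_pos)
      refine ⟨(ξ : Ordinal.{u}), ξ.toOrd.2, ?_⟩
      rw [hdual]
      refine Filter.mem_of_superset (hE _ hξ) fun a ha => ?_
      have h1 : c (r a) ∈ A := by rw [hr a]; exact a.2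
      have h2 : (⟨c (r a), h1⟩ : A) = a := Subtype.ext (hr a)
      have h3 : ((ξ : Ordinal.{u}) < π.ord) := ξ.toOrd.2
      rw [mem_ofPred_eq, dif_pos h1, h2] at ha
      change g a ≤ if h : (ξ : Ordinal.{u}) < π.ord then
        F (Ordinal.ToType.mk ⟨(ξ : Ordinal.{u}), h⟩) (r a) else 0
      rw [dif_pos h3, toType_mk_coe]
      exact ha
  calc π ≤ pseudopower σ := le_csSup (bddAbove_scaleLength σ) hlen
    _ = Order.succ σ := hSSH σ hsing
    _ ≤ Order.succ τ := Order.succ_le_succ hστ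

/-- Products of progressive families of distinct regular cardinals have small cofinal families. -/
theorem exists_cofinal_family (hSSH : SSH.{u}) {ι : Type u} {c : ι → Cardinal.{u}}
    (hc : ∀ i, (c i).IsRegular) (hinj : Function.Injective c) (hι : ∀ i, Order.succ #ι < c i)
    {τ : Cardinal.{u}} (hτ : ∀ i, c i ≤ τ) (hτ0 : ℵ₀ ≤ τ) :
    ∃ (J : Type u) (f : J → ι → Ordinal.{u}), #J ≤ Order.succ τ ∧ (∀ j, InProduct c (f j)) ∧
      ∀ g, InProduct c g → ∃ j, g ≤ f j := by
  classical
  have hχ : ℵ₀ ≤ Order.succ τ := hτ0.trans (Order.le_succ τ)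
  -- The extra successor makes room for `τ⁺` itself: a pair in `V × V` codes a length `π ≤ τ⁺` and a
  -- position `ξ < π`.
  let V := (Order.succ (Order.succ τ).ord).ToType
  have hV : #V = Order.succ τ := by
    simp only [V, mk_toType, Order.succ_eq_add_one, Ordinal.card_add_one, card_ord]
    exact add_one_eq hχ
  choose f hf hfD using fun π : {π : Cardinal.{u} // π.IsRegular} =>
    exists_universal_sequence hc hι π.2
  let base : V × V → ι → Ordinal.{u} := fun p =>
    if h : (Ordinal.card p.1).IsRegular ∧ (p.2 : Ordinal.{u}) < (Ordinal.card p.1).ord then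
      f ⟨Ordinal.card p.1, h.1⟩ (Ordinal.ToType.mk ⟨p.2, h.2⟩) else 0
  have hbase : ∀ p, InProduct c (base p) := by
    intro p
    dsimp only [base]
    split_ifs with h
    · exact hf _ _
    · exact inProduct_zero hc
  let fam : List (V × V) → ι → Ordinal.{u} := fun l => l.foldr (fun p h => base p ⊔ h) 0
  have hfam : ∀ l, InProduct c (fam l) := by
    intro l
    induction l with
    | nil => exact inProduct_zero hc
    | cons p l ih => exact (hbase p).sup ih
  have happ : ∀ l m, fam (l ++ m) = fam l ⊔ fam m := by
    intro l m
    induction l with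
    | nil => exact (sup_eq_right.2 (fun i => zero_le : (0 : ι → Ordinal.{u}) ≤ fam m)).symm
    | cons p l ih =>
      change base p ⊔ fam (l ++ m) = (base p ⊔ fam l) ⊔ fam m
      rw [ih, sup_assoc]
  refine ⟨List (V × V), fam, ?_, hfam, fun g hg => ?_⟩
  · have : Infinite V := by rw [infinite_iff, hV]; exact hχ
    rw [mk_list_eq_mk, mk_prod, lift_id, hV, mul_eq_self hχ]
  -- Compactness: `fam` is closed under finite joins, so the sets where `g` exceeds its members
  -- generate a proper filter. In an ultrafilter extending it, the universal sequence of the right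
  -- length dominates `g`, a contradiction.
  by_contra! hno
  have hne : (⨅ l, Filter.principal {i | fam l i < g i}).NeBot := by
    refine Filter.iInf_neBot_of_directed' ?_ fun l => ?_
    · intro l m
      refine ⟨l ++ m, ?_, ?_⟩ <;>
      · refine Filter.principal_mono.2 fun i (hi : fam (l ++ m) i < g i) => ?_
        rw [happ] at hi
        first | exact le_sup_left.trans_lt hi | exact le_sup_right.trans_lt hi
    · rw [Filter.principal_neBot_iff]
      obtain ⟨i, hi⟩ := not_forall.1 (hno l)
      exact ⟨i, not_le.1 hi⟩
  let D := Ultrafilter.of (⨅ l, Filter.principal {i | fam l i < g i})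
  have hD : ∀ l, ∀ᶠ i in D, fam l i < g i := fun l =>
    Ultrafilter.of_le _ (Filter.mem_iInf_of_mem l (Filter.mem_principal_self _))
  obtain ⟨π, hπ, F, hF⟩ := exists_isUltraScale hc D
  have hπτ := hF.length_le hSSH hc hinj (fun i => (Order.lt_succ _).trans (hι i)) hτ hπ
  obtain ⟨ξ, hξ⟩ := hfD ⟨π, hπ⟩ D F hF g hg
  have h1 : π.ord < Order.succ (Order.succ τ).ord := Order.lt_succ_iff.2 (ord_le_ord.2 hπτ)
  have h2 : (ξ : Ordinal.{u}) < Order.succ (Order.succ τ).ord := lt_trans ξ.toOrd.2 h1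
  let p : V × V := (Ordinal.ToType.mk ⟨π.ord, h1⟩, Ordinal.ToType.mk ⟨(ξ : Ordinal.{u}), h2⟩)
  have hp : base p = f ⟨π, hπ⟩ ξ := by
    have e1 : ((Ordinal.ToType.mk ⟨π.ord, h1⟩ : V) : Ordinal.{u}).card = π := by simp
    have key : ∀ (ρ : Cardinal.{u}) (e : ρ = π) (o : Ordinal.{u}) (h : ρ.IsRegular) (ho : o < ρ.ord),
        o = ξ → f ⟨ρ, h⟩ (Ordinal.ToType.mk ⟨o, ho⟩) = f ⟨π, hπ⟩ ξ := by
      rintro ρ rfl o h ho rfl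
      rw [toType_mk_coe]
    have hcond : (Ordinal.card p.1).IsRegular ∧
        (p.2 : Ordinal.{u}) < (Ordinal.card p.1).ord := by
      refine ⟨by rw [e1]; exact hπ, ?_⟩
      rw [e1]
      simp only [p, OrderIso.symm_apply_apply]
      exact ξ.toOrd.2
    dsimp only [base]
    rw [dif_pos hcond]
    exact key _ e1 _ _ _ (by simp [p])
  obtain ⟨i, h3, h4⟩ := (hξ.and (hD [p])).exists
  rw [← hp] at h3
  exact (le_sup_left.trans_lt h4).not_ge h3

theorem exists_reindex {α : Type*} {χ : Cardinal.{u}} {J : Type u} [Nonempty J] (hJ : #J ≤ χ)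
    (f : J → α) : ∃ f' : χ.ord.ToType → α, range f' = range f := by
  rw [← mk_ord_toType χ, Cardinal.le_def] at hJ
  obtain ⟨e⟩ := hJ
  exact ⟨f ∘ Function.invFun e, (Function.invFun_surjective e.injective).range_comp f⟩

theorem exists_monotone_cofinal_ordinal (δ : Ordinal.{u}) :
    ∃ e : Ordinal.{u} → Ordinal.{u}, (∀ a b, a ≤ b → b < δ.cof.ord → e a ≤ e b) ∧
      (∀ a < δ.cof.ord, e a < δ) ∧ ∀ β < δ, ∃ a < δ.cof.ord, β ≤ e a := by
  obtain ⟨e, he1, he2, he3⟩ := exists_monotone_cofinal δ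
  refine ⟨fun a => if h : a < δ.cof.ord then e (Ordinal.ToType.mk ⟨a, h⟩) else 0, ?_, ?_, ?_⟩
  · intro a b hab hb
    simp only [hb, hab.trans_lt hb, dite_true]
    exact he1 (Ordinal.ToType.mk.monotone hab)
  · intro a ha
    simp only [ha, dite_true]
    exact he2 _
  · intro β hβ
    obtain ⟨k, hk⟩ := he3 β hβ
    have h : (k : Ordinal.{u}) < δ.cof.ord := k.toOrd.2
    refine ⟨(k : Ordinal.{u}), h, ?_⟩
    change β ≤ if h : (k : Ordinal.{u}) < δ.cof.ord then e (Ordinal.ToType.mk ⟨k, h⟩) else 0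
    rw [dif_pos h, toType_mk_coe]
    exact hk

/-- Products of fewer than `κ` ordinals of cofinality at least `κ` have small cofinal families. -/
theorem exists_cofinal_family_ordinal (hSSH : SSH.{u}) {κ τ : Cardinal.{u}} (hκ : κ.IsRegular)
    (hκτ : κ ≤ τ) {ι : Type u} (hι : #ι < κ) {δ : ι → Ordinal.{u}} (hδ : ∀ i, κ ≤ (δ i).cof)
    (hδτ : ∀ i, δ i ≤ τ.ord) :
    ∃ f : (Order.succ τ).ord.ToType → ι → Ordinal.{u}, (∀ t i, f t i < δ i) ∧
      ∀ g : ι → Ordinal.{u}, (∀ i, g i < δ i) → ∃ t, g ≤ f t := by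
  classical
  have hτ0 : ℵ₀ ≤ τ := hκ.aleph0_le.trans hκτ
  have hδreg : ∀ i, (δ i).cof.IsRegular := fun i =>
    isRegular_cof (Ordinal.one_lt_cof_iff.1 (one_lt_aleph0.trans_le (hκ.aleph0_le.trans (hδ i))))
  choose e he1 he2 he3 using fun i => exists_monotone_cofinal_ordinal (δ i)
  -- `exists_cofinal_family` needs distinct cardinals above the successor of the index size. So
  -- equal cofinalities are merged in `Q`, and cofinality exactly `κ` is treated apart, where one
  -- ordinal below `κ` bounds all coordinates.
  let ι₁ := {i // κ < (δ i).cof}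
  let Q := Quotient (Setoid.ker fun i : ι₁ => (δ i).cof)
  let c : Q → Cardinal.{u} := Setoid.kerLift fun i : ι₁ => (δ i).cof
  let q : ι₁ → Q := Quotient.mk _
  have hcq : ∀ i, c (q i) = (δ i).cof := fun i => rfl
  have hQ : #Q < κ := mk_quotient_le.trans_lt ((mk_subtype_le _).trans_lt hι)
  have hall : ∀ P : Q → Prop, (∀ i, P (q i)) → ∀ x, P x := fun P h x => Quotient.inductionOn x h
  obtain ⟨J, f, hJ, hf, hfc⟩ := exists_cofinal_family hSSH (c := c)
    (hall _ fun i => hδreg i) (Setoid.kerLift_injective _)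
    (hall _ fun i => (Order.succ_le_of_lt hQ).trans_lt i.2) (τ := τ)
    (hall _ fun i => by
      rw [hcq, ← ord_le_ord]
      exact (Ordinal.ord_cof_le _).trans (hδτ i)) hτ0
  let index : J × κ.ord.ToType → ι → Ordinal.{u} := fun p i =>
    if h : κ < (δ i).cof then f p.1 (q ⟨i, h⟩) else p.2
  have hindex : ∀ p i, index p i < (δ i).cof.ord := by
    intro p i
    dsimp only [index]
    split_ifs with h
    · exact hf p.1 (q ⟨i, h⟩)
    · exact lt_of_lt_of_le p.2.toOrd.2 (ord_le_ord.2 (hδ i))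
  let fam : J × κ.ord.ToType → ι → Ordinal.{u} := fun p i => e i (index p i)
  have hcof : ∀ g : ι → Ordinal.{u}, (∀ i, g i < δ i) → ∃ p, g ≤ fam p := by
    intro g hg
    choose γ hγ1 hγ2 using fun i => he3 i (g i) (hg i)
    obtain ⟨j, hj⟩ := hfc (fun x => ⨆ i : ι₁, if q i = x then γ i else 0) (by
      refine hall _ fun i => Ordinal.iSup_lt_of_lt_cof ?_ fun k => ?_
      · rw [hcq, Ordinal.cof_ord_cof]
        exact (mk_subtype_le _).trans_lt (hι.trans i.2)
      · split_ifs with h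
        · rw [← h]
          exact hγ1 k
        · rw [hcq]
          exact (hδreg _).ord_pos)
    have hk : (⨆ i : ι, if κ < (δ i).cof then 0 else γ i) < κ.ord := by
      refine Ordinal.iSup_lt_of_lt_cof (by rwa [hκ.cof_ord]) fun i => ?_
      split_ifs with h
      · exact hκ.ord_pos
      · rw [(hδ i).antisymm (not_lt.1 h)]
        exact hγ1 i
    refine ⟨(j, Ordinal.ToType.mk ⟨_, hk⟩), fun i => (hγ2 i).trans (he1 _ _ _ ?_ (hindex _ _))⟩
    dsimp only [index]
    split_ifs with h
    · refine le_trans ?_ (hj (q ⟨i, h⟩))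
      have := Ordinal.le_iSup (fun k : ι₁ => if q k = q ⟨i, h⟩ then γ k else 0) ⟨i, h⟩
      simpa using this
    · have := Ordinal.le_iSup (fun i : ι => if κ < (δ i).cof then 0 else γ i) i
      simpa [h] using this
  have hne : Nonempty (J × κ.ord.ToType) := by
    obtain ⟨p, -⟩ := hcof 0 fun i => lt_of_le_of_lt zero_le (he2 i 0 (hδreg i).ord_pos)
    exact ⟨p⟩
  obtain ⟨f', hf'⟩ := exists_reindex (χ := Order.succ τ) (by
    rw [mk_prod, lift_id, lift_id, mk_ord_toType]
    exact mul_le_of_le (hτ0.trans (Order.le_succ τ)) hJ (hκτ.trans (Order.le_succ τ))) fam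
  refine ⟨f', fun t i => ?_, fun g hg => ?_⟩
  · obtain ⟨p, hp⟩ := hf' ▸ mem_range_self t
    rw [← hp]
    exact he2 i _ (hindex p i)
  · obtain ⟨p, hp⟩ := hcof g hg
    obtain ⟨t, ht⟩ := hf' ▸ mem_range_self (f := fam) p
    exact ⟨t, ht ▸ hp⟩

/-! ### Walks on ordinals and covering by few sets. -/

/-- One step of the walk: from `ν` many ordinals to `ν` many ordinals. -/
theorem exists_walk_step (hSSH : SSH.{u}) {ν τ : Cardinal.{u}} (hν : ℵ₀ ≤ ν) (hντ : ν < τ)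
    (a : ν.ord.ToType → Ordinal.{u}) (ha : ∀ i, a i ≤ τ.ord) :
    ∃ s : (Order.succ τ).ord.ToType → ν.ord.ToType → Ordinal.{u}, (∀ t i, s t i ≤ τ.ord) ∧
      ∀ y : ν.ord.ToType → Ordinal.{u}, ∃ t, ∀ k i, y k < a i → ∃ j, y k ≤ s t j ∧ s t j < a i := by
  classical
  have hκ : (Order.succ ν).IsRegular := isRegular_succ hν
  let ι := {i // Order.succ ν ≤ (a i).cof}
  obtain ⟨f, hf1, hf2⟩ := exists_cofinal_family_ordinal hSSH hκ (Order.succ_le_of_lt hντ)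
    (ι := ι) (δ := fun i => a i)
    ((mk_subtype_le _).trans_lt (by rw [mk_ord_toType]; exact Order.lt_succ ν)) (fun i => i.2)
    fun i => ha i
  choose e he1 he2 he3 using fun i => exists_monotone_cofinal (a i)
  obtain ⟨φ⟩ : Nonempty (ν.ord.ToType ≃ ν.ord.ToType × ν.ord.ToType) := by
    rw [← Cardinal.eq, mk_prod, lift_id, mk_ord_toType, mul_eq_self hν]
  -- Below `a i` of cofinality above `ν`, a single guessed ordinal bounds the part of `y` below `a
  -- i`; for smaller cofinality, an entire cofinal sequence is listed. The padding value `0` is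
  -- harmless.
  let v : (Order.succ τ).ord.ToType → ν.ord.ToType × ν.ord.ToType → Ordinal.{u} := fun t p =>
    if h : Order.succ ν ≤ (a p.1).cof then f t ⟨p.1, h⟩
    else if h' : (p.2 : Ordinal.{u}) < (a p.1).cof.ord then
      e p.1 (Ordinal.ToType.mk ⟨p.2, h'⟩) else 0
  refine ⟨fun t i => v t (φ i), fun t i => ?_, fun y => ?_⟩
  · dsimp only [v]
    split_ifs with h h'
    · exact ((hf1 t ⟨_, h⟩).trans_le (ha _)).le
    · exact ((he2 _ _).trans_le (ha _)).le
    · exact zero_le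
  · obtain ⟨t, ht⟩ := hf2 (fun i => ⨆ k, if y k < a i then y k else 0) (by
      intro i
      refine Ordinal.iSup_lt_of_lt_cof ?_ fun k => ?_
      · rw [mk_ord_toType]
        exact Order.succ_le_iff.1 i.2
      · split_ifs with h
        · exact h
        · refine Ordinal.cof_pos.1 (hκ.pos.trans_le i.2))
    refine ⟨t, fun k i hki => ?_⟩
    by_cases h : Order.succ ν ≤ (a i).cof
    · refine ⟨φ.symm (i, i), ?_⟩
      simp only [Equiv.apply_symm_apply, v, h, dite_true]
      refine ⟨le_trans ?_ (ht ⟨i, h⟩), hf1 _ _⟩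
      have := Ordinal.le_iSup (fun k => if y k < a i then y k else 0) k
      simpa [hki] using this
    · obtain ⟨l, hl⟩ := he3 i _ hki
      have hl1 : (l : Ordinal.{u}) < (a i).cof.ord := l.toOrd.2
      have hl2 : (l : Ordinal.{u}) < ν.ord :=
        hl1.trans_le (ord_le_ord.2 (Order.lt_succ_iff.1 (not_le.1 h)))
      refine ⟨φ.symm (i, Ordinal.ToType.mk ⟨(l : Ordinal.{u}), hl2⟩), ?_⟩
      have : v t (i, Ordinal.ToType.mk ⟨(l : Ordinal.{u}), hl2⟩) = e i l := by
        dsimp only [v]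
        rw [dif_neg h, dif_pos (by simpa using hl1)]
        simp
      simp only [Equiv.apply_symm_apply, this]
      exact ⟨hl, he2 _ _⟩

/-- Under `SSH`, there is a family of at most `τ⁺` sets of size at most `ν` such that each subset
of `τ` of size at most `ν` is covered by countably many of them. -/
theorem exists_countable_covering (hSSH : SSH.{u}) {ν τ : Cardinal.{u}} (hν : ℵ₀ ≤ ν)
    (hντ : ν < τ) :
    ∃ X : List (Order.succ τ).ord.ToType → ν.ord.ToType → Ordinal.{u},
      ∀ y : ν.ord.ToType → Ordinal.{u}, (∀ k, y k < τ.ord) →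
        ∃ s : ℕ → List (Order.succ τ).ord.ToType, ∀ k, ∃ n j, y k = X (s n) j := by
  let P := {a : ν.ord.ToType → Ordinal.{u} // ∀ i, a i ≤ τ.ord}
  choose S hS1 hS2 using fun a : P => exists_walk_step hSSH hν hντ a.1 a.2
  let X : List (Order.succ τ).ord.ToType → P := fun l =>
    l.foldr (fun t a => ⟨S a t, hS1 a t⟩) ⟨fun _ => τ.ord, fun _ => le_rfl⟩
  refine ⟨fun l => (X l).1, fun y hy => ?_⟩
  choose t ht using fun a : P => hS2 a y
  let s : ℕ → List (Order.succ τ).ord.ToType := fun n =>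
    Nat.rec [] (fun _ l => t (X l) :: l) n
  have hs : ∀ n, (X (s (n + 1))).1 = S (X (s n)) (t (X (s n))) := fun n => rfl
  refine ⟨s, fun k => ?_⟩
  -- The least visited ordinal `β ≥ y k` must equal `y k`, since otherwise the next step visits one
  -- in `[y k, β)`.
  have hne : {β | y k ≤ β ∧ ∃ n j, β = (X (s n)).1 j}.Nonempty := by
    obtain ⟨j⟩ : Nonempty ν.ord.ToType := by
      rw [← mk_ne_zero_iff, mk_ord_toType]
      exact (aleph0_pos.trans_le hν).ne'
    exact ⟨τ.ord, (hy k).le, 0, j, rfl⟩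
  obtain ⟨β, ⟨hβ, n, j, hj⟩, hmin⟩ := WellFounded.has_min Ordinal.lt_wf _ hne
  refine ⟨n, j, (hβ.eq_of_not_lt fun hlt => ?_).trans hj⟩
  obtain ⟨j', h1, h2⟩ := ht (X (s n)) k j (hj ▸ hlt)
  rw [← hj, ← hs] at h2
  exact hmin _ ⟨by rw [hs]; exact h1, n + 1, j', rfl⟩ h2

/-- If `λ` is singular then, under `SSH`, there are at most `λ` sets of size at most `ν` such that
each subset of `λ` of size at most `ν` is covered by at most `cf(λ)` of them. -/
theorem exists_cof_covering (hSSH : SSH.{u}) {ν lam : Cardinal.{u}} (hν : ℵ₀ ≤ ν)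
    (hνlam : Order.succ ν < lam) (hcf : lam.ord.cof < lam) :
    ∃ (C : Type u) (X : C → ν.ord.ToType → Ordinal.{u}), #C ≤ lam ∧
      ∀ y : ν.ord.ToType → Ordinal.{u}, (∀ k, y k < lam.ord) →
        ∃ s : lam.ord.cof.ord.ToType × ℕ → C, ∀ k, ∃ p j, y k = X (s p) j := by
  classical
  have hlam0 : ℵ₀ ≤ lam := hν.trans ((Order.le_succ ν).trans hνlam.le)
  have hlim : Order.IsSuccLimit lam := IsSingular.isSuccLimit ⟨hlam0, hcf.ne⟩
  obtain ⟨e, he1, he2, he3⟩ := exists_monotone_cofinal lam.ord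
  let τ : lam.ord.cof.ord.ToType → Cardinal.{u} := fun i =>
    max (Order.succ ν) (Order.succ (e i).card)
  have hτ : ∀ i, τ i < lam := fun i => max_lt hνlam (hlim.succ_lt (lt_ord.1 (he2 i)))
  have hντ : ∀ i, ν < τ i := fun i => (Order.lt_succ ν).trans_le (le_max_left _ _)
  have heτ : ∀ i, e i < (τ i).ord := fun i =>
    lt_ord.2 ((Order.lt_succ _).trans_le (le_max_right _ _))
  choose X hX using fun i => exists_countable_covering hSSH hν (hντ i)
  refine ⟨Σ i, List (Order.succ (τ i)).ord.ToType, fun c => X c.1 c.2, ?_, fun y hy => ?_⟩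
  · rw [mk_sigma]
    refine (sum_le_mk_mul_iSup _).trans (mul_le_of_le hlam0 (by simpa using hcf.le) ?_)
    refine ciSup_le' fun i => ?_
    have hs : ℵ₀ ≤ Order.succ (τ i) := hν.trans ((hντ i).le.trans (Order.le_succ _))
    have : Infinite (Order.succ (τ i)).ord.ToType := by rwa [infinite_iff, mk_ord_toType]
    rw [mk_list_eq_mk, mk_ord_toType]
    exact Order.succ_le_of_lt (hτ i)
  -- Each `y` is cut off at every `τ i`, the removed values becoming `0`; every `y k` survives for
  -- some `i`.
  · choose s hs using fun i => hX i (fun k => if y k < (τ i).ord then y k else 0) (by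
      intro k
      split_ifs with h
      · exact h
      · exact lt_of_le_of_lt zero_le (heτ i))
    refine ⟨fun p => ⟨p.1, s p.1 p.2⟩, fun k => ?_⟩
    obtain ⟨i, hi⟩ := he3 (y k) (hy k)
    obtain ⟨n, j, hj⟩ := hs i k
    rw [if_pos (hi.trans_lt (heτ i))] at hj
    exact ⟨(i, n), j, hj⟩

/-! ### Thin families. -/

/-- An indexed family of subsets of `L` is `κ`-thin if each set of size less than `κ` includes fewer
than `κ` of its terms. -/
def IsThin (κ : Cardinal.{u}) {L S : Type u} (z : S → Set L) : Prop :=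
  ∀ a : Set L, #a < κ → #{i | z i ⊆ a} < κ

/-- Under `SSH`, a thin family of sets of size less than `κ` yields one of sets of size less
than `μ`. -/
theorem IsThin.exists_small (hSSH : SSH.{u}) {μ ν lam : Cardinal.{u}} (hμ : ℵ₀ < μ) (hν : ℵ₀ ≤ ν)
    (hνlam : Order.succ ν < lam) (hcf : lam.ord.cof < lam) (hcfμ : lam.ord.cof < μ) {S : Type u}
    {y : S → Set lam.ord.ToType} (hy : ∀ α, #(y α) < Order.succ ν)
    (hthin : IsThin (Order.succ ν) y) :
    ∃ z : S → Set lam.ord.ToType, (∀ α, #(z α) < μ) ∧ IsThin (Order.succ ν) z := by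
  classical
  have hκ : (Order.succ ν).IsRegular := isRegular_succ hν
  obtain ⟨C, X, hC, hX⟩ := exists_cof_covering hSSH hν hνlam hcf
  rw [← mk_ord_toType lam, Cardinal.le_def] at hC
  obtain ⟨em⟩ := hC
  have hlam0 : lam.ord ≠ 0 := by
    rw [Ne, ord_eq_zero]
    exact (zero_le.trans_lt hνlam).ne'
  have enum : ∀ α, ∃ w : ν.ord.ToType → lam.ord.ToType, y α ⊆ range w := by
    intro α
    have h := Order.lt_succ_iff.1 (hy α)
    rw [← mk_ord_toType ν, Cardinal.le_def] at h
    obtain ⟨φ⟩ := h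
    have : Nonempty lam.ord.ToType := Ordinal.nonempty_toType_iff.2 hlam0
    rcases isEmpty_or_nonempty (y α) with h | h
    · refine ⟨fun _ => Classical.arbitrary _, fun β hβ => (h.false ⟨β, hβ⟩).elim⟩
    · refine ⟨fun k => (Function.invFun φ k).1, fun β hβ => ⟨φ ⟨β, hβ⟩, ?_⟩⟩
      simp only [Function.leftInverse_invFun φ.injective _]
  choose w hw using enum
  choose s hs using fun α => hX (fun k => (w α k : Ordinal.{u})) fun k => (w α k).toOrd.2
  refine ⟨fun α => range (em ∘ s α), fun α => ?_, fun a ha => ?_⟩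
  · refine mk_range_le.trans_lt ?_
    rw [mk_prod, mk_ord_toType, mk_nat, lift_aleph0, lift_uzero]
    exact mul_lt_of_lt hμ.le hcfμ hμ
  -- `b` is the union of the sets coded by points of `a`. It has size less than `κ` and includes
  -- each `y α` whose code lies in `a`, so thinness of `y` applies to `b`.
  · let b : Set lam.ord.ToType := ⋃ c : em ⁻¹' a, ⋃ j, {β | (β : Ordinal.{u}) = X c.1 j}
    have hb : #b < Order.succ ν := by
      refine (card_iUnion_lt_iff_forall_of_isRegular hκ
        ((mk_preimage_of_injective _ _ em.injective).trans_lt ha)).2 fun c => ?_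
      refine (card_iUnion_lt_iff_forall_of_isRegular hκ
        (by rw [mk_ord_toType]; exact Order.lt_succ ν)).2 fun j => ?_
      refine lt_of_le_of_lt ?_ (one_lt_aleph0.trans_le hκ.aleph0_le)
      refine mk_le_one_iff_set_subsingleton.2 fun β hβ γ hγ => ?_
      refine Ordinal.ToType.mk.symm.injective (Subtype.ext ?_)
      exact Eq.trans hβ (Eq.symm hγ)
    refine (mk_le_mk_of_subset fun α (hα : range (em ∘ s α) ⊆ a) => ?_).trans_lt (hthin b hb)
    rw [mem_ofPred_eq]
    intro β hβ
    obtain ⟨k, rfl⟩ := hw α hβ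
    obtain ⟨p, j, hj⟩ := hs α k
    exact mem_iUnion.2 ⟨⟨s α p, hα ⟨p, rfl⟩⟩, mem_iUnion.2 ⟨j, hj⟩⟩

theorem IsThin.sumElim_singleton {κ : Cardinal.{u}} (hκ : ℵ₀ ≤ κ) {L S : Type u} {z : S → Set L}
    (hz : IsThin κ z) : IsThin κ (Sum.elim (fun β => {β}) z : L ⊕ S → Set L) := by
  intro a ha
  have : {i | (Sum.elim (fun β => {β}) z : L ⊕ S → Set L) i ⊆ a} ⊆
      Sum.inl '' a ∪ Sum.inr '' {i | z i ⊆ a} := by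
    rintro (β | i) h
    · exact Or.inl ⟨β, h rfl, rfl⟩
    · exact Or.inr ⟨i, h, rfl⟩
  refine (mk_le_mk_of_subset this).trans_lt ((mk_union_le _ _).trans_lt ?_)
  exact add_lt_of_lt hκ (mk_image_le.trans_lt ha) (mk_image_le.trans_lt (hz a ha))

/-- `λ ≤ u(κ, λ)` for `κ < λ`. -/
theorem le_coveringNumber {κ lam : Cardinal.{u}} (hκ : ℵ₀ ≤ κ) (hκlam : κ < lam) :
    lam ≤ coveringNumber κ lam := by
  obtain ⟨s, hs, hs'⟩ := Order.exists_cof_eq (PKappa κ lam)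
  rw [coveringNumber, ← hs']
  by_contra! hlt
  have hcov : (⋃ a : s, (a.1.1 : Set lam.ord.ToType)) = Set.univ := by
    refine eq_univ_of_forall fun β => ?_
    obtain ⟨a, ha, hβ⟩ := hs ⟨{β}, by
      rw [mk_singleton]
      exact one_lt_aleph0.trans_le hκ⟩
    exact mem_iUnion.2 ⟨⟨a, ha⟩, hβ rfl⟩
  have h1 : #(Set.univ : Set lam.ord.ToType) ≤ max #s κ * max #s κ := by
    rw [← hcov]
    refine (mk_iUnion_le _).trans (mul_le_mul' (le_max_left _ _) ?_)
    exact ciSup_le' fun a => a.1.2.le.trans (le_max_right _ _)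
  rw [mk_univ, mk_ord_toType, mul_eq_self (hκ.trans (le_max_right _ _))] at h1
  exact h1.not_gt (max_lt hlt hκlam)

/-- The singletons can be adjoined without changing the number of sets because `λ ≤ u(κ, λ)`. -/
theorem exists_thin_family (hSSH : SSH.{u}) {μ ν lam : Cardinal.{u}} (hμ : ℵ₀ < μ) (hν : ℵ₀ ≤ ν)
    (hνlam : Order.succ ν < lam) (hcf : lam.ord.cof < lam) (hcfμ : lam.ord.cof < μ)
    {F : Set (PKappa (Order.succ ν) lam)} (hF : IsPseudoKurepa F)
    (hcard : #F = coveringNumber (Order.succ ν) lam) :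
    ∃ z : (coveringNumber (Order.succ ν) lam).ord.ToType → Set lam.ord.ToType,
      (∀ α, #(z α) < μ) ∧ IsThin (Order.succ ν) z ∧ ∀ β, ∃ α, z α = {β} := by
  have hκ : ℵ₀ ≤ Order.succ ν := hν.trans (Order.le_succ ν)
  have hthin : IsThin (Order.succ ν) (fun y : F => (y.1.1 : Set lam.ord.ToType)) := by
    intro a ha
    refine lt_of_le_of_lt ?_ (hF ⟨a, ha⟩)
    refine mk_le_of_injective (f := fun y => ⟨y.1.1, y.1.2, y.2⟩) fun y y' h => ?_
    exact Subtype.ext (Subtype.ext (congrArg (fun t => t.1) h))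
  obtain ⟨z, hz, hzthin⟩ := hthin.exists_small hSSH hμ hν hνlam hcf hcfμ fun y => y.1.2
  obtain ⟨φ⟩ : Nonempty ((coveringNumber (Order.succ ν) lam).ord.ToType ≃ lam.ord.ToType ⊕ F) := by
    have h := le_coveringNumber hκ hνlam
    rw [← Cardinal.eq, mk_sum, lift_id, lift_id, mk_ord_toType, mk_ord_toType, hcard]
    exact (add_eq_right (hκ.trans (hνlam.le.trans h)) h).symm
  refine ⟨fun α => Sum.elim (fun β => {β}) z (φ α), fun α => ?_, fun a ha => ?_, fun β => ?_⟩
  · dsimp only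
    rcases φ α with β | y
    · rw [Sum.elim_inl, mk_singleton]
      exact one_lt_aleph0.trans hμ
    · exact hz y
  · refine lt_of_le_of_lt ?_ (hzthin.sumElim_singleton hκ a ha)
    exact mk_preimage_of_injective φ _ φ.injective
  · exact ⟨φ.symm (Sum.inl β), by simp⟩

/-! ### The `μ`-nonstationary ideal. -/

theorem exists_strict_upper_bound {κ σ : Cardinal.{u}} (hκ : κ.IsRegular) (hκσ : κ ≤ σ)
    {β : Type u} (hβ : #β < κ) (p : β → PKappa κ σ) (x : PKappa κ σ) :
    ∃ v : PKappa κ σ, x < v ∧ ∀ b, p b < v := by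
  let w : Set σ.ord.ToType := x.1 ∪ ⋃ b, (p b).1
  have hw : #w < κ := (mk_union_le _ _).trans_lt (add_lt_of_lt hκ.aleph0_le x.2
    ((card_iUnion_lt_iff_forall_of_isRegular hκ hβ).2 fun b => (p b).2))
  -- A new point ensures strictness, as `μ`-closure concerns strictly increasing sequences only.
  obtain ⟨γ, hγ⟩ : ∃ γ, γ ∉ w := by
    by_contra! h
    rw [eq_univ_of_forall h, mk_univ, mk_ord_toType] at hw
    exact hw.not_ge hκσ
  have hv : #(insert γ w : Set σ.ord.ToType) < κ := by
    rw [mk_insert hγ]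
    exact add_lt_of_lt hκ.aleph0_le hw (one_lt_aleph0.trans_le hκ.aleph0_le)
  have key : ∀ y : PKappa κ σ, y.1 ⊆ w → y < ⟨insert γ w, hv⟩ := fun y hy =>
    lt_of_le_of_ne (show y.1 ⊆ insert γ w from hy.trans (subset_insert γ w)) fun e =>
      hγ (hy (by rw [e]; exact mem_insert γ w))
  exact ⟨⟨insert γ w, hv⟩, key x subset_union_left,
    fun b => key _ ((subset_iUnion (fun b => (p b).1) b).trans subset_union_right)⟩

/-- For cofinality, two strictly increasing `μ`-sequences, one from each club, are interleaved above
`x`; their common union lies in both clubs. -/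
theorem IsMuClub.inter {μ κ σ : Cardinal.{u}} (hμ : μ.IsRegular) (hκ : κ.IsRegular)
    (hμκ : μ < κ) (hκσ : κ ≤ σ)
    {C₁ C₂ : Set (PKappa κ σ)} (h₁ : IsMuClub μ C₁) (h₂ : IsMuClub μ C₂) :
    IsMuClub μ (C₁ ∩ C₂) := by
  refine ⟨fun s hs hsC => ?_, fun x => ?_⟩
  · obtain ⟨c, hc, hc'⟩ := h₁.1 s hs fun i => (hsC i).1
    obtain ⟨d, hd, hd'⟩ := h₂.1 s hs fun i => (hsC i).2
    have : c = d := Subtype.ext (hc'.trans hd'.symm)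
    exact ⟨c, ⟨hc, this ▸ hd⟩, hc'⟩
  · have step : ∀ (i : μ.ord.ToType) (prev : ∀ j, j < i → PKappa κ σ × PKappa κ σ),
        ∃ r : PKappa κ σ × PKappa κ σ, r.1 ∈ C₁ ∧ r.2 ∈ C₂ ∧ x ≤ r.1 ∧ r.1 ≤ r.2 ∧
          ∀ j (hj : j < i), (prev j hj).2 < r.1 := by
      intro i prev
      obtain ⟨v, hxv, hv⟩ := exists_strict_upper_bound hκ hκσ (β := Iio i)
        ((mk_set_le _).trans_lt (by rwa [mk_ord_toType])) (fun j => (prev j.1 j.2).2) x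
      obtain ⟨a, ha, hva⟩ := h₁.2 v
      obtain ⟨b, hb, hab⟩ := h₂.2 a
      exact ⟨(a, b), ha, hb, hxv.le.trans hva, hab, fun j hj => (hv ⟨j, hj⟩).trans_le hva⟩
    choose next hn1 hn2 hn3 hn4 hn5 using step
    let f : μ.ord.ToType → PKappa κ σ × PKappa κ σ :=
      (wellFounded_lt (α := μ.ord.ToType)).fix next
    have hf : ∀ i, f i = next i fun j _ => f j := fun i => WellFounded.fix_eq _ _ _
    have h1 : ∀ i, (f i).1 ∈ C₁ := fun i => by rw [hf i]; exact hn1 i _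
    have h2 : ∀ i, (f i).2 ∈ C₂ := fun i => by rw [hf i]; exact hn2 i _
    have h3 : ∀ i, x ≤ (f i).1 := fun i => by rw [hf i]; exact hn3 i _
    have h4 : ∀ i, (f i).1 ≤ (f i).2 := fun i => by rw [hf i]; exact hn4 i _
    have h5 : ∀ i j, j < i → (f j).2 < (f i).1 := fun i j hj => by
      rw [hf i]
      exact hn5 i (fun j _ => f j) j hj
    obtain ⟨c, hc, hc'⟩ := h₁.1 (fun i => (f i).1) (fun j i hj => (h4 j).trans_lt (h5 i j hj)) h1
    obtain ⟨d, hd, hd'⟩ := h₂.1 (fun i => (f i).2) (fun j i hj => (h5 i j hj).trans_le (h4 i)) h2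
    have hcd : c = d := by
      refine Subtype.ext ?_
      rw [hc', hd']
      refine subset_antisymm (iUnion_mono fun i => h4 i) (iUnion_subset fun i => ?_)
      obtain ⟨j, hj⟩ := exists_forall_lt_of_isRegular hμ
        (mk_punit.trans_lt (one_lt_aleph0.trans_le hμ.aleph0_le)) fun _ : PUnit.{u + 1} => i
      exact subset_iUnion_of_subset j (h5 j i (hj ⟨⟩)).le
    refine ⟨c, ⟨hc, hcd ▸ hd⟩, ?_⟩
    change x.1 ⊆ c.1
    rw [hc']
    exact subset_iUnion_of_subset (Ordinal.ToType.mk ⟨0, hμ.ord_pos⟩) (h3 _)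

theorem exists_coe_eq_iUnion {κ σ : Cardinal.{u}} (hκ : κ.IsRegular) {β : Type u} (hβ : #β < κ)
    (s : β → PKappa κ σ) : ∃ c : PKappa κ σ, c.1 = ⋃ b, (s b).1 :=
  ⟨⟨_, (card_iUnion_lt_iff_forall_of_isRegular hκ hβ).2 fun b => (s b).2⟩, rfl⟩

theorem isIdealOn_muNonstationary {μ κ σ : Cardinal.{u}} (hμ : μ.IsRegular) (hκ : κ.IsRegular)
    (hμκ : μ < κ) (hκσ : κ ≤ σ) : IsIdealOn (muNonstationary μ κ σ) := by
  refine ⟨⟨?_, ⟨∅, Set.univ, ⟨?_, fun x => ⟨x, mem_univ x, le_rfl⟩⟩, empty_inter _⟩, ?_⟩, ?_⟩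
  · rintro A B hBA ⟨C, hC, hAC⟩
    exact ⟨C, hC, subset_empty_iff.1 ((inter_subset_inter_left C hBA).trans hAC.subset)⟩
  · intro s _ _
    obtain ⟨c, hc⟩ := exists_coe_eq_iUnion hκ (by rwa [mk_ord_toType]) s
    exact ⟨c, mem_univ c, hc⟩
  · rintro A ⟨C, hC, hAC⟩ B ⟨C', hC', hBC'⟩
    refine ⟨A ∪ B, ⟨C ∩ C', hC.inter hμ hκ hμκ hκσ hC', ?_⟩, subset_union_left, subset_union_right⟩
    refine eq_empty_of_forall_notMem fun x hx => ?_
    rcases hx.1 with h | h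
    · exact (hAC ▸ ⟨h, hx.2.1⟩ : x ∈ (∅ : Set (PKappa κ σ)))
    · exact (hBC' ▸ ⟨h, hx.2.2⟩ : x ∈ (∅ : Set (PKappa κ σ)))
  · rintro ⟨C, hC, h⟩
    rw [univ_inter] at h
    obtain ⟨c, hc, -⟩ := hC.2 ⟨∅, by rw [mk_eq_zero]; exact hκ.pos⟩
    exact (h ▸ hc : c ∈ (∅ : Set (PKappa κ σ)))

theorem mem_dualFamily_muNonstationary {μ κ σ : Cardinal.{u}} {A : Set (PKappa κ σ)} :
    A ∈ dualFamily (muNonstationary μ κ σ) ↔ ∃ C, IsMuClub μ C ∧ C ⊆ A := by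
  refine exists_congr fun C => and_congr_right fun _ => ?_
  rw [← disjoint_iff_inter_eq_empty, disjoint_compl_left_iff_subset]

/-! ### The isomorphism. -/

/-- A cofinal order embedding that commutes with unions of increasing `μ`-sequences is an
isomorphism of the `μ`-nonstationary ideals. -/
theorem idealsIsomorphic_of_orderEmbedding {μ κ lam σ : Cardinal.{u}} (hμ : μ.IsRegular)
    (hκ : κ.IsRegular) (hμκ : μ < κ) (hκlam : κ ≤ lam) (hκσ : κ ≤ σ)
    (h : PKappa κ lam ↪o PKappa κ σ) (hcof : IsCofinal (range h))
    (hunion : ∀ (s : μ.ord.ToType → PKappa κ lam) (c : PKappa κ lam), StrictMono s →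
      c.1 = ⋃ i, (s i).1 → (h c).1 = ⋃ i, (h (s i)).1) :
    IdealsIsomorphic (muNonstationary μ κ lam) (muNonstationary μ κ σ) := by
  have himage : ∀ C : Set (PKappa κ lam), IsMuClub μ C → IsMuClub μ (h '' C) := by
    intro C hC
    refine ⟨fun s hs hsC => ?_, fun x => ?_⟩
    · choose t htC hts using hsC
      obtain rfl : h ∘ t = s := funext hts
      have ht : StrictMono t := fun i j hij => h.lt_iff_lt.1 (hs hij)
      obtain ⟨c, hc, hct⟩ := hC.1 t ht htC
      exact ⟨h c, mem_image_of_mem h hc, hunion t c ht hct⟩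
    · obtain ⟨_, ⟨a, rfl⟩, ha⟩ := hcof x
      obtain ⟨c, hc, hac⟩ := hC.2 a
      exact ⟨h c, mem_image_of_mem h hc, ha.trans (h.monotone hac)⟩
  have hpreimage : ∀ C : Set (PKappa κ σ), IsMuClub μ C → C ⊆ range h → IsMuClub μ (h ⁻¹' C) := by
    intro C hC hCh
    refine ⟨fun s hs hsC => ?_, fun x => ?_⟩
    · obtain ⟨d, hd, hd'⟩ := hC.1 (h ∘ s) (h.strictMono.comp hs) hsC
      obtain ⟨c, hc⟩ := exists_coe_eq_iUnion hκ (by rwa [mk_ord_toType]) s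
      have : h c = d := Subtype.ext ((hunion s c hs hc).trans hd'.symm)
      exact ⟨c, show h c ∈ C from this ▸ hd, hc⟩
    · obtain ⟨d, hd, hxd⟩ := hC.2 (h x)
      obtain ⟨c, rfl⟩ := hCh hd
      exact ⟨c, hd, h.le_iff_le.1 hxd⟩
  have hclub : IsMuClub μ (Set.univ : Set (PKappa κ lam)) := by
    refine ⟨fun s _ _ => ?_, fun x => ⟨x, mem_univ x, le_rfl⟩⟩
    obtain ⟨c, hc⟩ := exists_coe_eq_iUnion hκ (by rwa [mk_ord_toType]) s
    exact ⟨c, mem_univ c, hc⟩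
  refine ⟨isIdealOn_muNonstationary hμ hκ hμκ hκlam, isIdealOn_muNonstationary hμ hκ hμκ hκσ,
    Set.univ, mem_dualFamily_muNonstationary.2 ⟨_, hclub, subset_rfl⟩, range h,
    mem_dualFamily_muNonstationary.2 ⟨_, himage _ hclub, image_subset_range _ _⟩, h, ?_, ?_, ?_⟩
  · rw [← image_univ]
    exact h.injective.injOn.bijOn_image
  · intro A hA _
    obtain ⟨C, hC, hCA⟩ := mem_dualFamily_muNonstationary.1 hA
    exact mem_dualFamily_muNonstationary.2 ⟨_, himage C hC, image_mono hCA⟩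
  · intro B hB hBh
    obtain ⟨C, hC, hCB⟩ := mem_dualFamily_muNonstationary.1 hB
    refine ⟨h ⁻¹' B, ⟨mem_dualFamily_muNonstationary.2
      ⟨_, hpreimage C hC (hCB.trans hBh), preimage_mono hCB⟩, subset_univ _,
      (image_preimage_eq_of_subset hBh).symm⟩, ?_⟩
    rintro A ⟨-, -, rfl⟩
    exact (preimage_image_eq A h.injective).symm

theorem idealsIsomorphic_of_isThin {μ κ lam σ : Cardinal.{u}} (hμ : μ.IsRegular)
    (hκ : κ.IsRegular) (hμκ : μ < κ) (hκlam : κ ≤ lam) (hκσ : κ ≤ σ)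
    (z : σ.ord.ToType → Set lam.ord.ToType) (hz : ∀ α, #(z α) < μ) (hthin : IsThin κ z)
    (hsing : ∀ β, ∃ α, z α = {β}) :
    IdealsIsomorphic (muNonstationary μ κ lam) (muNonstationary μ κ σ) := by
  let h : PKappa κ lam ↪o PKappa κ σ := OrderEmbedding.ofMapLEIff
    (fun a => ⟨{α | z α ⊆ a.1}, hthin a.1 a.2⟩) fun a b => by
      refine ⟨fun hab β hβ => ?_, fun hab α (hα : z α ⊆ a.1) => hα.trans hab⟩
      obtain ⟨α, hα⟩ := hsing β
      have h1 : z α ⊆ b.1 := hab (show z α ⊆ a.1 by rwa [hα, singleton_subset_iff])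
      rwa [hα, singleton_subset_iff] at h1
  refine idealsIsomorphic_of_orderEmbedding hμ hκ hμκ hκlam hκσ h (fun x => ?_) fun s c hs hc => ?_
  · refine ⟨_, ⟨⟨⋃ α : x.1, z α, (card_iUnion_lt_iff_forall_of_isRegular hκ x.2).2
      fun α => (hz α).trans hμκ⟩, rfl⟩, fun α hα => ?_⟩
    exact subset_iUnion (fun α : x.1 => z α) ⟨α, hα⟩
  · ext α
    rw [mem_iUnion]
    change z α ⊆ c.1 ↔ ∃ i, z α ⊆ (s i).1
    rw [hc]
    refine ⟨fun hα => ?_, fun ⟨i, hi⟩ => hi.trans (subset_iUnion (fun i => (s i).1) i)⟩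
    -- The fewer than `μ` points of `z α` enter the increasing sequence at stages bounded below `μ`,
    -- so a single term includes `z α`.
    choose f hf using fun β : z α => mem_iUnion.1 (hα β.2)
    obtain ⟨i, hi⟩ := exists_forall_lt_of_isRegular hμ (hz α) f
    exact ⟨i, fun β hβ => hs.monotone (hi ⟨β, hβ⟩).le (hf ⟨β, hβ⟩)⟩

theorem proposition1p18 (μ κ lam ν : Cardinal.{u})
    (hμ : μ.IsRegular) (hκ : κ.IsRegular) (hμκ : μ < κ) (hκlam : κ < lam)
    (hSSH : SSH.{u}) (hcf : lam.ord.cof < μ)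
    (hν : κ = Order.succ ν) (hcfν : ν.ord.cof ≠ lam.ord.cof)
    (hPK : ∃ F : Set (PKappa κ lam), IsPseudoKurepa F ∧ Cardinal.mk F = coveringNumber κ lam) :
    IdealsIsomorphic (muNonstationary μ κ lam) (muNonstationary μ κ (coveringNumber κ lam)) := by
  subst hν
  obtain ⟨F, hF, hcard⟩ := hPK
  have hμν : μ ≤ ν := Order.lt_succ_iff.1 hμκ
  have hlam : ℵ₀ ≤ lam := hκ.aleph0_le.trans hκlam.le
  -- `cf(λ)` is infinite. Uncountability of `μ` is needed because codes have size up to `cf(λ) ·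
  -- ℵ₀`.
  have hμ0 : ℵ₀ < μ := by
    refine lt_of_le_of_lt ?_ hcf
    exact Ordinal.aleph0_le_cof_iff.2 (Ordinal.one_lt_cof_iff.2 (isSuccLimit_ord hlam))
  obtain ⟨z, hz, hthin, hsing⟩ := exists_thin_family hSSH hμ0 (hμ.aleph0_le.trans hμν) hκlam
    (hcf.trans (hμκ.trans hκlam)) hcf hF hcard
  exact idealsIsomorphic_of_isThin hμ hκ hμκ hκlam.le
    (hκlam.le.trans (le_coveringNumber hκ.aleph0_le hκlam)) z hz hthin hsing
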